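/- **Theorem 3.1.** Let $X$ be a rack, i.e. a set with a binary operation $*$ such that every map $s_x\colon X\to X$, $s_x(a)=a*x$, is bijective and $(x*y)*z=(x*z)*(y*z)$ for all $x,y,z\in X$. Let $\mathrm{Inn}(X)$ be the group of permutations of $X$ generated by all $s_x$, multiplied by opposite composition, so that it acts on $X$ from the right; let $\mathcal O_X$ be its set of orbits, and let $e_{[x]}$ denote the generator of the free abelian group $\mathbb Z^{\oplus\mathcal O_X}$ given by the orbit of $x$. Let $$\mathrm{As}(X)=\langle e_x\ (x\in X)\mid e_xe_y=e_ye_{x*y}\ (x,y\in X)\rangle,$$ let $\alpha\colon\mathrm{As}(X)\to\mathbb Z^{\oplus\mathcal O_X}$ and $\psi\colon\mathrm{As}(X)\to\mathrm{Inn}(X)$ be the homomorphisms with $\alpha(e_x)=e_{[x]}$ and $\psi(e_x)=s_x$, and let $A$ be the kernel and $\overline{\mathrm{Inn}}(X)$ the image of $\alpha\times\psi\colon\mathrm{As}(X)\to\mathbb Z^{\oplus\mathcal O_X}\times\mathrm{Inn}(X)$. Then $A$ is central in $\mathrm{As}(X)$. Put $\bar s_x=(\alpha\times\psi)(e_x)$,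 and let $\mathrm{Stab}_{\overline{\mathrm{Inn}}(X)}(x)$ be the stabilizer of $x$ for the right action of $\overline{\mathrm{Inn}}(X)$ on $X$ through the second projection; its elements commute with $\bar s_x$. Homology $H_2$ has coefficients in $\mathbb Z$, all coefficients are trivial modules, and for commuting elements $g,h$ of a group $G$ the Pontryagin product $\langle g,h\rangle\in H_2(G)$ is the class of the inhomogeneous cycle $[g|h]-[h|g]$. Then there is an isomorphism $$\theta\colon H_2(\overline{\mathrm{Inn}}(X))\Big/\sum_{x\in X}\langle\bar s_x,\mathrm{Stab}_{\overline{\mathrm{Inn}}(X)}(x)\rangle\ \xrightarrow{\ \cong\ }\ A,$$ where the denominator is the subgroup generated by all $\langle\bar s_x,h\rangle$ with $x\in X$ and $h\in\mathrm{Stab}_{\overline{\mathrm{Inn}}(X)}(x)$, with the following property. Let $\varphi\colon H_2(\overline{\mathrm{Inn}}(X))\to A$ be the quotient map followed by $\theta$. The evaluation map $$H^2(\overline{\mathrm{Inn}}(X),A)\to\mathrm{Hom}(H_2(\overline{\mathrm{Inn}}(X)),A),$$ which evaluates $2$-cocycles on $2$-cycles, is an isomorphism, and the central extension $$1\to A\to\mathrm{As}(X)\to\overline{\mathrm{Inn}}(X)\to1$$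 is equivalent to the extension associated with the class in $H^2(\overline{\mathrm{Inn}}(X),A)$ that corresponds to $\varphi$. Here the extension associated with the class of a $2$-cocycle $c$ is the set $A\times\overline{\mathrm{Inn}}(X)$ with multiplication $(a,g)(b,h)=(a\,b\,c(g,h),\,gh)$. -/

import Mathlib

universe u

open scoped Quandles

noncomputable section

/-! ## Integral group homology and cohomology in degree two -/

namespace GroupH2

/-- The ring of integers, placed in the universe of the group whose homology is taken. -/
abbrev Z : Type u := ULift.{u} ℤ

/-- The second homology group of `G` with (trivial) integral coefficients. -/
abbrev H₂ (G : Type u) [Group G] : Type u :=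
  groupHomology.H2 (Rep.trivial Z.{u} G Z.{u})

/-- The second cohomology group of `G` with coefficients in the trivial `G`-module `M`. -/
abbrev Hc₂ (G : Type u) [Group G] (M : Type u) [AddCommGroup M] : Type u :=
  groupCohomology.H2 (Rep.trivial Z.{u} G M)

/-- Inhomogeneous integral 2-cycles of `G`. -/
abbrev Cyc (G : Type u) [Group G] : Submodule Z.{u} (G × G →₀ Z.{u}) :=
  groupHomology.cycles₂ (Rep.trivial Z.{u} G Z.{u})

/-- Inhomogeneous 2-cocycles of `G` with values in the trivial `G`-module `M`. -/
abbrev Coc (G : Type u) [Group G] (M : Type u) [AddCommGroup M] : Submodule Z.{u} (G × G → M) :=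
  groupCohomology.cocycles₂ (Rep.trivial Z.{u} G M)

variable {G : Type u} [Group G] {M : Type u} [AddCommGroup M]

/-- The homology class of a 2-cycle. -/
def cycClass (G : Type u) [Group G] : Cyc G →+ H₂ G :=
  (groupHomology.H2π (Rep.trivial Z.{u} G Z.{u})).hom.toAddMonoidHom

/-- The cohomology class of a 2-cocycle. -/
def cocClass (G : Type u) [Group G] (M : Type u) [AddCommGroup M] : Coc G M →+ Hc₂ G M :=
  (groupCohomology.H2π (Rep.trivial Z.{u} G M)).hom.toAddMonoidHom

lemma cycClass_surjective : Function.Surjective (cycClass G) :=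
  (ModuleCat.epi_iff_surjective _).1 inferInstance

lemma cocClass_surjective : Function.Surjective (cocClass G M) :=
  (ModuleCat.epi_iff_surjective _).1 inferInstance

lemma coc_eq (c : Coc G M) (g h j : G) :
    c.1 (g * h, j) + c.1 (g, h) = c.1 (h, j) + c.1 (g, h * j) := by
  simpa using (groupCohomology.mem_cocycles₂_iff (A := Rep.trivial Z.{u} G M) c.1).1 c.2 g h j

/-- The value `∑ z(g,h) • c(g,h)` of a 2-cochain on a 2-chain. -/
def pair (c : G × G → M) : (G × G →₀ Z.{u}) →ₗ[Z.{u}] M := Finsupp.linearCombination Z.{u} c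

lemma pair_boundary (c : Coc G M) (z : Cyc G) (hz : cycClass G z = 0) : pair c.1 z.1 = 0 := by
  obtain ⟨y, hy⟩ := (groupHomology.H2π_eq_zero_iff (A := Rep.trivial Z.{u} G Z.{u}) z).1 hz
  have key : (pair c.1).comp (groupHomology.d₃₂ (Rep.trivial Z.{u} G Z.{u})).hom = 0 := by
    ext ⟨g, h, j⟩
    have := coc_eq c g h j
    simp [pair, groupHomology.d₃₂]
    rw [sub_add_eq_add_sub, sub_sub, this, sub_self]
  rw [← hy]
  exact congrArg (fun f => f y) key

lemma pair_coboundary (c : Coc G M) (hc : cocClass G M c = 0) (z : Cyc G) : pair c.1 z.1 = 0 := by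
  obtain ⟨y, hy⟩ := (groupCohomology.H2π_eq_zero_iff (A := Rep.trivial Z.{u} G M) c).1 hc
  have key : pair c.1 =
      (Finsupp.linearCombination Z.{u} y).comp
        (groupHomology.d₂₁ (Rep.trivial Z.{u} G Z.{u})).hom := by
    have hy' : c.1 = groupCohomology.d₁₂ (Rep.trivial Z.{u} G M) y := hy.symm
    ext ⟨g, h⟩
    rw [hy']
    simp [pair, groupHomology.d₂₁]
  rw [key, LinearMap.comp_apply]
  have hz : (groupHomology.d₂₁ (Rep.trivial Z.{u} G Z.{u})).hom z.1 = 0 := z.2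
  rw [hz, map_zero]

/-- The homomorphism `H₂(G) → M` given by evaluating a 2-cocycle on 2-cycles. -/
def evalCocycle (c : Coc G M) : H₂ G →+ M :=
  (cycClass G).liftOfSurjective cycClass_surjective
    ⟨((pair c.1).comp (Cyc G).subtype).toAddMonoidHom, fun z hz => pair_boundary c z hz⟩

lemma evalCocycle_cycClass (c : Coc G M) (z : Cyc G) :
    evalCocycle c (cycClass G z) = pair c.1 z.1 :=
  AddMonoidHom.liftOfRightInverse_comp_apply _ _ _ _ z

/-- The evaluation map `H²(G, M) → Hom(H₂(G), M)` of the universal coefficient theorem. -/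
def evaluation (G : Type u) [Group G] (M : Type u) [AddCommGroup M] :
    Hc₂ G M →+ (H₂ G →+ M) :=
  (cocClass G M).liftOfSurjective cocClass_surjective
    ⟨{ toFun := evalCocycle
       map_zero' := by
        ext x
        obtain ⟨z, rfl⟩ := cycClass_surjective x
        simp [evalCocycle_cycClass, pair]
       map_add' := fun c d => by
        ext x
        obtain ⟨z, rfl⟩ := cycClass_surjective x
        simp only [evalCocycle_cycClass, pair, AddMonoidHom.add_apply,
          Finsupp.linearCombination_apply, Finsupp.sum]
        simp [Finset.sum_add_distrib] },
      fun c hc => by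
        rw [AddMonoidHom.mem_ker]
        ext x
        obtain ⟨z, rfl⟩ := cycClass_surjective x
        simpa [evalCocycle_cycClass] using pair_coboundary c hc z⟩

/-- The evaluation map is computed on representatives by `∑ z(g,h) • c(g,h)`. -/
lemma evaluation_cocClass_cycClass (c : Coc G M) (z : Cyc G) :
    evaluation G M (cocClass G M c) (cycClass G z) = z.1.sum fun p n => n.down • c.1 p := by
  have h : evaluation G M (cocClass G M c) = evalCocycle c :=
    AddMonoidHom.liftOfRightInverse_comp_apply _ _ _ _ c
  rw [h, evalCocycle_cycClass]
  rfl

/-- The Pontryagin product `⟨g, h⟩ ∈ H₂(G)` of a commuting pair: the class of the inhomogeneous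
cycle `[g|h] - [h|g]`, i.e. the image of the generator `[(1,0)|(0,1)] - [(0,1)|(1,0)]` of
`H₂(ℤ × ℤ)` under the homomorphism `ℤ × ℤ → G` with `(1,0) ↦ g`, `(0,1) ↦ h`. -/
def pontryagin (g h : G) (hgh : Commute g h) : H₂ G :=
  cycClass G ⟨Finsupp.single (g, h) 1 - Finsupp.single (h, g) 1, by
    rw [groupHomology.mem_cycles₂_iff, Finsupp.sum_sub_index, Finsupp.sum_sub_index]
    · simp [hgh.eq, add_comm]
    · simp
    · simp [add_sub_add_comm]⟩

/-! ### Central extension defined by a cocycle -/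

variable {N : Type u} [CommGroup N]

/-- The set `N × G`, with the multiplication `(a, g)(b, h) = (a b c(g, h), g h)`. -/
@[ext]
structure CocycleGroup (c : Coc G (Additive N)) where
  /-- the component in the kernel -/
  left : N
  /-- the component in the quotient -/
  right : G

namespace CocycleGroup

variable (c : Coc G (Additive N))

/-- The cocycle written multiplicatively. -/
def mulCoc (g h : G) : N := Additive.toMul (c.1 (g, h))

lemma mulCoc_eq (g h j : G) :
    mulCoc c (g * h) j * mulCoc c g h = mulCoc c h j * mulCoc c g (h * j) :=
  congrArg Additive.toMul (coc_eq c g h j)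

lemma mulCoc_one_left (g : G) : mulCoc c 1 g = mulCoc c 1 1 := by
  simpa using (mulCoc_eq c 1 1 g).symm

lemma mulCoc_one_right (g : G) : mulCoc c g 1 = mulCoc c 1 1 := by
  simpa using mulCoc_eq c g 1 1

instance : Mul (CocycleGroup c) :=
  ⟨fun a b => ⟨a.left * b.left * mulCoc c a.right b.right, a.right * b.right⟩⟩

instance : One (CocycleGroup c) := ⟨⟨(mulCoc c 1 1)⁻¹, 1⟩⟩

instance : Inv (CocycleGroup c) :=
  ⟨fun a => ⟨(a.left * mulCoc c a.right⁻¹ a.right * mulCoc c 1 1)⁻¹, a.right⁻¹⟩⟩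

@[simp] lemma mul_left (a b : CocycleGroup c) :
    (a * b).left = a.left * b.left * mulCoc c a.right b.right := rfl
@[simp] lemma mul_right (a b : CocycleGroup c) : (a * b).right = a.right * b.right := rfl
@[simp] lemma one_left : (1 : CocycleGroup c).left = (mulCoc c 1 1)⁻¹ := rfl
@[simp] lemma one_right : (1 : CocycleGroup c).right = 1 := rfl
@[simp] lemma inv_left (a : CocycleGroup c) :
    (a⁻¹).left = (a.left * mulCoc c a.right⁻¹ a.right * mulCoc c 1 1)⁻¹ := rfl
@[simp] lemma inv_right (a : CocycleGroup c) : (a⁻¹).right = a.right⁻¹ := rfl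

instance : Group (CocycleGroup c) :=
  Group.ofLeftAxioms
    (fun a b d => by
      ext
      · have := mulCoc_eq c a.right b.right d.right
        simp only [mul_left, mul_right]
        calc _ = a.left * b.left * d.left *
              (mulCoc c (a.right * b.right) d.right * mulCoc c a.right b.right) := by
              simp only [mul_assoc, mul_comm, mul_left_comm]
          _ = _ := by rw [this]; simp only [mul_assoc, mul_comm, mul_left_comm]
      · simp [mul_assoc])
    (fun a => by ext <;> simp [mulCoc_one_left, mul_comm])
    (fun a => by
      ext
      · simp only [mul_left, inv_left, inv_right, one_left, mul_inv]
        rw [mul_right_comm _ _ a.left, mul_right_comm _ _ a.left, inv_mul_cancel, one_mul,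
          mul_right_comm, inv_mul_cancel, one_mul]
      · simp)

end CocycleGroup

/-- The central extension `1 → N → N ×_c G → G → 1` defined by the 2-cocycle `c`. -/
def cocycleExtension (c : Coc G (Additive N)) : GroupExtension N (CocycleGroup c) G where
  inl :=
    { toFun := fun a => ⟨a * (CocycleGroup.mulCoc c 1 1)⁻¹, 1⟩
      map_one' := by ext <;> simp
      map_mul' := fun a b => by
        ext <;> simp [mul_assoc, mul_left_comm] }
  rightHom :=
    { toFun := fun a => a.right
      map_one' := rfl
      map_mul' := fun _ _ => rfl }
  inl_injective := fun a b h => by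
    have := congrArg CocycleGroup.left h
    simpa using this
  range_inl_eq_ker_rightHom := by
    ext a
    constructor
    · rintro ⟨b, rfl⟩
      rfl
    · intro h
      refine ⟨a.left * CocycleGroup.mulCoc c 1 1, ?_⟩
      ext
      · simp
      · exact (show a.right = 1 from h).symm
  rightHom_surjective := fun g => ⟨⟨1, g⟩, rfl⟩

/-- The group extension `S` is (equivalent to) the central extension associated with the
cohomology class `κ ∈ H²(G, N)`. -/
def HasClass {E : Type u} [Group E] (S : GroupExtension N E G) (κ : Hc₂ G (Additive N)) : Prop :=
  ∃ c : Coc G (Additive N), cocClass G (Additive N) c = κ ∧ Nonempty (S.Equiv (cocycleExtension c))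

end GroupH2

/-! ## Groups attached to a rack

A right rack operation `a * x` is written `x ◃ a`, so that `Rack.act' x` is the permutation
`s_x : a ↦ a * x`. -/

namespace AssocGroup

open MulOpposite GroupH2

variable (X : Type u) [Rack X]

/-- The relators of `e_x e_y = e_y e_{x*y}`. -/
def rels : Set (FreeGroup X) :=
  {r | ∃ x y : X, r = FreeGroup.of x * FreeGroup.of y *
    (FreeGroup.of y * FreeGroup.of (y ◃ x))⁻¹}

/-- The associated group `⟨e_x (x ∈ X) ∣ e_x e_y = e_y e_{x*y}⟩` of the rack `X`. -/
abbrev As : Type u := PresentedGroup (rels X)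

/-- The inner automorphism group, generated by the `s_x`, multiplied by opposite composition. -/
def Inn : Subgroup (Equiv.Perm X)ᵐᵒᵖ :=
  Subgroup.closure (Set.range fun x : X => op (Rack.act' x))

variable {X}

/-- The generator `e_x` of the associated group. -/
def e (x : X) : As X := PresentedGroup.of x

/-- The right action `x · g` of `Inn X` on `X`. -/
def actInn (x : X) (g : Inn X) : X := (unop g.1) x

lemma actInn_one (x : X) : actInn x 1 = x := rfl

lemma actInn_mul (x : X) (g h : Inn X) : actInn x (g * h) = actInn (actInn x g) h := rfl

/-- The inner automorphism `s_x`, as an element of `Inn X`. -/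
def s (x : X) : Inn X := ⟨op (Rack.act' x), Subgroup.subset_closure ⟨x, rfl⟩⟩

lemma actInn_s (a x : X) : actInn a (s x) = x ◃ a := rfl

variable (X) in
/-- Two points are equivalent when they lie in the same orbit of `Inn X`. -/
def orbitSetoid : Setoid X where
  r x y := ∃ g : Inn X, actInn x g = y
  iseqv :=
    { refl := fun x => ⟨1, rfl⟩
      symm := by
        rintro x _ ⟨g, rfl⟩
        exact ⟨g⁻¹, by rw [← actInn_mul, mul_inv_cancel, actInn_one]⟩
      trans := by
        rintro x _ _ ⟨g, rfl⟩ ⟨h, rfl⟩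
        exact ⟨g * h, actInn_mul x g h⟩ }

variable (X) in
/-- The set of connected components (orbits of `Inn X`). -/
def Orbits : Type u := Quotient (orbitSetoid X)

/-- The connected component of a point. -/
def orbit (x : X) : Orbits X := Quotient.mk (orbitSetoid X) x

lemma orbit_act (x y : X) : orbit (y ◃ x) = orbit x :=
  (Quotient.sound (s := orbitSetoid X) ⟨s y, rfl⟩).symm

variable (X) in
/-- The abelianization map `α`, with `e_x ↦ e_{[x]}`. -/
def α : As X →* Multiplicative (Orbits X →₀ ℤ) :=
  PresentedGroup.toGroup (f := fun x => Multiplicative.ofAdd (Finsupp.single (orbit x) 1)) (by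
    rintro r ⟨x, y, rfl⟩
    simp only [map_mul, map_inv, FreeGroup.lift_apply_of, orbit_act]
    rw [mul_inv_eq_one, mul_comm])

variable (X) in
/-- The canonical epimorphism `ψ`, with `e_x ↦ s_x`. -/
def ψ : As X →* Inn X :=
  PresentedGroup.toGroup (f := s) (by
    rintro r ⟨x, y, rfl⟩
    simp only [map_mul, map_inv, FreeGroup.lift_apply_of]
    rw [mul_inv_eq_one]
    apply Subtype.ext
    apply unop_injective
    ext a
    exact Shelf.self_distrib)

@[simp] lemma α_e (x : X) : α X (e x) = Multiplicative.ofAdd (Finsupp.single (orbit x) 1) :=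
  PresentedGroup.toGroup.of _

@[simp] lemma ψ_e (x : X) : ψ X (e x) = s x := PresentedGroup.toGroup.of _

variable (X) in
/-- The homomorphism `α × ψ`. -/
def αψ : As X →* Multiplicative (Orbits X →₀ ℤ) × Inn X := (α X).prod (ψ X)

variable (X) in
/-- The image of `α × ψ`. -/
abbrev InnBar : Subgroup (Multiplicative (Orbits X →₀ ℤ) × Inn X) := (αψ X).range

variable (X) in
/-- The kernel `A` of `α × ψ`. -/
abbrev A : Subgroup (As X) := (αψ X).ker

/-- The element `(α × ψ)(e_x)` of `InnBar X`. -/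
def sBar (x : X) : InnBar X := (αψ X).rangeRestrict (e x)

/-- The stabilizer of `x` in `InnBar X`, which acts on `X` via the second projection. -/
def stab (x : X) : Subgroup (InnBar X) where
  carrier := {g | actInn x g.1.2 = x}
  one_mem' := rfl
  mul_mem' := by
    intro g h hg hh
    simp only [Set.mem_ofPred_eq] at *
    rw [Subgroup.coe_mul, Prod.snd_mul, actInn_mul, hg, hh]
  inv_mem' := by
    intro g hg
    simp only [Set.mem_ofPred_eq] at *
    rw [Subgroup.coe_inv, Prod.snd_inv]
    conv_lhs => rw [← hg]
    rw [← actInn_mul, mul_inv_cancel, actInn_one]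

lemma e_mul_e (x y : X) : e x * e y = e y * e (y ◃ x) := by
  have h : PresentedGroup.mk (rels X) (FreeGroup.of x * FreeGroup.of y *
      (FreeGroup.of y * FreeGroup.of (y ◃ x))⁻¹) = 1 :=
    PresentedGroup.one_of_mem ⟨x, y, rfl⟩
  rw [map_mul, map_inv, mul_inv_eq_one, map_mul, map_mul] at h
  exact h

lemma e_mul (g : As X) : ∀ x : X, e x * g = g * e (actInn x (ψ X g)) := by
  have hg : g ∈ Subgroup.closure (Set.range (PresentedGroup.of : X → As X)) := by
    rw [PresentedGroup.closure_range_of]; trivial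
  induction hg using Subgroup.closure_induction with
  | mem g hg =>
    obtain ⟨y, rfl⟩ := hg
    intro x
    have : ψ X (PresentedGroup.of y) = s y := ψ_e y
    rw [this, actInn_s]
    exact e_mul_e x y
  | one => intro x; simp [actInn_one]
  | mul g h _ _ ihg ihh =>
    intro x
    rw [map_mul, actInn_mul, ← mul_assoc, ihg, mul_assoc, ihh, mul_assoc]
  | inv g _ ih =>
    intro x
    have h := ih (actInn x (ψ X g)⁻¹)
    rw [← actInn_mul, inv_mul_cancel, actInn_one] at h
    rw [map_inv, eq_inv_mul_iff_mul_eq, ← mul_assoc, ← h, mul_inv_cancel_right]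

/-- The kernel of `α × ψ` is central. -/
lemma A_le_center : A X ≤ Subgroup.center (As X) := by
  intro g hg
  have hψ : ψ X g = 1 := congrArg Prod.snd (MonoidHom.mem_ker.1 hg)
  have hc : Subgroup.centralizer {g} = (⊤ : Subgroup (As X)) := by
    rw [eq_top_iff, ← PresentedGroup.closure_range_of, Subgroup.closure_le]
    rintro _ ⟨x, rfl⟩
    rw [SetLike.mem_coe, Subgroup.mem_centralizer_singleton_iff]
    have := e_mul g x
    rw [hψ, actInn_one] at this
    exact this
  rw [Subgroup.mem_center_iff]
  intro h
  have hh : h ∈ Subgroup.centralizer {g} := hc ▸ Subgroup.mem_top h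
  exact Subgroup.mem_centralizer_singleton_iff.1 hh

instance : CommGroup (A X) :=
  { (inferInstance : Group (A X)) with
    mul_comm := fun a b =>
      Subtype.ext ((Subgroup.mem_center_iff.1 (A_le_center b.2)) a.1) }

lemma commute_sBar (x : X) {h : InnBar X} (hh : h ∈ stab x) : Commute (sBar x) h := by
  obtain ⟨_, g, rfl⟩ := h
  apply Subtype.ext
  have h1 := e_mul g x
  have h2 : actInn x (ψ X g) = x := hh
  rw [h2] at h1
  have h3 := congrArg (αψ X) h1
  rw [map_mul, map_mul] at h3
  exact h3

variable (X) in
/-- The subgroup of `H₂(InnBar X)` generated by all Pontryagin products `⟨s̄_x, h⟩` with `x ∈ X`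
and `h` in the stabilizer of `x`. -/
def pontryaginSubgroup : AddSubgroup (H₂ (InnBar X)) :=
  ⨆ x : X, AddSubgroup.closure
    {z | ∃ (h : InnBar X) (hh : h ∈ stab x), z = pontryagin (sBar x) h (commute_sBar x hh)}

variable (X) in
/-- The central extension `1 → A → As(X) → InnBar(X) → 1`. -/
def asExtension : GroupExtension (A X) (As X) (InnBar X) where
  inl := (A X).subtype
  rightHom := (αψ X).rangeRestrict
  inl_injective := Subtype.val_injective
  range_inl_eq_ker_rightHom := by
    rw [Subgroup.range_subtype, MonoidHom.ker_rangeRestrict]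
  rightHom_surjective := (αψ X).rangeRestrict_surjective

end AssocGroup

end

/-!
The first homology of `InnBar X` is free on the orbits, since `α` is the abelianization map of
`As X` and factors through `InnBar X`. So evaluation is an isomorphism by the universal coefficient
theorem. Let `φ` be the evaluation of the class of `As X`.

The image of `φ` is `A ∩ [As X, As X]`, which is all of `A` because `A` lies in the kernel of `α`.
Two elements of a central extension commute if and only if the evaluation of its class kills the
Pontryagin product of their images. Hence `φ` kills the Pontryagin products `⟨s̄_x, h⟩`, since
`e_x` commutes with the lifts of the stabilizer of `x`. Conversely, let `P` be the subgroup they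
generate and take the extension `E` by `H₂ / P` whose class evaluates to the quotient map. In `E`
the lifts of `s̄_x` commute with the lifts of the stabilizer of `x`, so conjugating one lift of
`s̄_x` per orbit gives well-defined elements satisfying the relations of `As X`. The resulting map
`As X → E` over `InnBar X` shows that the quotient map `H₂ → H₂ / P` factors through `φ`, whence
`ker φ ≤ P`.
-/

noncomputable section

/-! ## The universal coefficient theorem in degree two -/

section Projective

variable {R D M : Type*} [Ring R] [AddCommGroup D] [AddCommGroup M] [Module R D] [Module R M]

lemma exists_retraction_of_projective_quotient (B : Submodule R D) [Module.Projective R (D ⧸ B)] :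
    ∃ r : D →ₗ[R] B, r ∘ₗ B.subtype = .id := by
  have hsplit : ∃ i, B.mkQ ∘ₗ i = .id :=
    Module.projective_lifting_property B.mkQ .id B.mkQ_surjective
  exact (((LinearMap.exact_subtype_mkQ B).split_tfae'.out 0 1 rfl rfl).1
    ⟨B.subtype_injective, hsplit⟩).2

lemma exists_extend_of_projective_quotient (B : Submodule R D) [Module.Projective R (D ⧸ B)]
    (f : B →ₗ[R] M) : ∃ F : D →ₗ[R] M, F ∘ₗ B.subtype = f := by
  obtain ⟨r, hr⟩ := exists_retraction_of_projective_quotient B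
  exact ⟨f ∘ₗ r, by rw [LinearMap.comp_assoc, hr, LinearMap.comp_id]⟩

lemma projective_of_projective_quotient (B : Submodule R D) [Module.Projective R D]
    [Module.Projective R (D ⧸ B)] : Module.Projective R B := by
  obtain ⟨r, hr⟩ := exists_retraction_of_projective_quotient B
  exact .of_split B.subtype r hr

end Projective

namespace GroupH2

lemma projective_of_addEquiv {M P : Type*} [AddCommGroup M] [Module Z.{u} M]
    [AddCommGroup P] [Module.Projective ℤ P] (e : P ≃+ M) : Module.Projective Z.{u} M := by
  let σ : ℤ →+* Z.{u} := ULift.ringEquiv.symm.toRingHom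
  let σ' : Z.{u} →+* ℤ := ULift.ringEquiv.toRingHom
  have : RingHomInvPair σ σ' := ⟨rfl, rfl⟩
  have : RingHomInvPair σ' σ := ⟨rfl, rfl⟩
  refine .of_equiv (σ := σ) ({ e with map_smul' := fun n x => ?_ } : P ≃ₛₗ[σ] M)
  refine (map_zsmul e n x).trans ?_
  rw [eq_intCast σ n]
  exact (Int.cast_smul_eq_zsmul Z.{u} n (e x)).symm

lemma pair_single {G M : Type u} [AddCommGroup M] (c : G × G → M) (p : G × G) :
    pair c (Finsupp.single p 1) = c p := by
  simp [pair]

variable {G : Type u} [Group G] {M : Type u} [AddCommGroup M]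

variable (G) in
/-- The first homology group of `G` with (trivial) integral coefficients. -/
abbrev H₁ : Type u := groupHomology.H1 (Rep.trivial Z.{u} G Z.{u})

lemma projective_H₁ [Module.Projective ℤ (Additive (Abelianization G))] :
    Module.Projective Z.{u} (H₁ G) :=
  projective_of_addEquiv <| AddEquiv.symm <|
    (groupHomology.H1AddEquivOfIsTrivial (Rep.trivial Z.{u} G Z.{u})).trans
      ((TensorProduct.congr (.refl ℤ _) ULift.moduleEquiv).trans (TensorProduct.rid ℤ _)).toAddEquiv

variable (G) in
/-- The homology class of an integral 1-chain, all of which are cycles. -/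
def chainClass : (G →₀ Z.{u}) →ₗ[Z.{u}] H₁ G :=
  (groupHomology.H1π (Rep.trivial Z.{u} G Z.{u})).hom ∘ₗ
    (groupHomology.cycles₁IsoOfIsTrivial (Rep.trivial Z.{u} G Z.{u})).toLinearEquiv.symm

lemma chainClass_surjective : Function.Surjective (chainClass G) :=
  ((ModuleCat.epi_iff_surjective (groupHomology.H1π _)).1 inferInstance).comp
    (LinearEquiv.surjective _)

variable (G) in
/-- The boundary map from inhomogeneous integral 2-chains to 1-chains of `G`. -/
abbrev boundary : (G × G →₀ Z.{u}) →ₗ[Z.{u}] (G →₀ Z.{u}) :=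
  (groupHomology.d₂₁ (Rep.trivial Z.{u} G Z.{u})).hom

lemma boundary_single (g h : G) (n : Z.{u}) : boundary G (Finsupp.single (g, h) n) =
    Finsupp.single h n - Finsupp.single (g * h) n + Finsupp.single g n :=
  groupHomology.d₂₁_single (A := Rep.trivial Z.{u} G Z.{u}) (g, h) n

lemma ker_chainClass : LinearMap.ker (chainClass G) = LinearMap.range (boundary G) :=
  Submodule.ext fun _ => groupHomology.H1π_eq_zero_iff (A := Rep.trivial Z.{u} G Z.{u}) _

lemma projective_chains_quotient_boundaries [Module.Projective Z.{u} (H₁ G)] :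
    Module.Projective Z.{u} ((G →₀ Z.{u}) ⧸ LinearMap.range (boundary G)) := by
  rw [← ker_chainClass]
  exact .of_equiv' ((chainClass G).quotKerEquivOfSurjective chainClass_surjective).symm

lemma projective_chains_quotient_cycles [Module.Projective Z.{u} (H₁ G)] :
    Module.Projective Z.{u} ((G × G →₀ Z.{u}) ⧸ Cyc G) := by
  have := projective_chains_quotient_boundaries (G := G)
  have := projective_of_projective_quotient (LinearMap.range (boundary G))
  exact .of_equiv' (boundary G).quotKerEquivRange.symm

lemma evaluation_cocClass (c : Coc G M) :
    evaluation G M (cocClass G M c) = evalCocycle c :=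
  AddMonoidHom.liftOfRightInverse_comp_apply _ _ _ _ c

lemma cocClass_eq_zero_iff (c : Coc G M) :
    cocClass G M c = 0 ↔ ∃ b : G → M, ∀ g h, c.1 (g, h) = b h - b (g * h) + b g := by
  refine (groupCohomology.H2π_eq_zero_iff (A := Rep.trivial Z.{u} G M) c).trans ?_
  refine exists_congr fun b => funext_iff.trans (Prod.forall.trans ?_)
  exact forall₂_congr fun g h => eq_comm.trans <| Eq.congr_right <|
    groupCohomology.d₁₂_hom_apply (A := Rep.trivial Z.{u} G M) b (g, h)

lemma evaluation_injective [Module.Projective Z.{u} (H₁ G)] :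
    Function.Injective (evaluation G M) := by
  rw [injective_iff_map_eq_zero]
  intro κ hκ
  obtain ⟨c, rfl⟩ := cocClass_surjective κ
  have hker : LinearMap.ker (boundary G) ≤ LinearMap.ker (pair c.1) := fun z hz => by
    rw [LinearMap.mem_ker, ← evalCocycle_cycClass c ⟨z, hz⟩, ← evaluation_cocClass, hκ,
      AddMonoidHom.zero_apply]
  have := projective_chains_quotient_boundaries (G := G)
  obtain ⟨b, hb⟩ := exists_extend_of_projective_quotient (LinearMap.range (boundary G))
    ((LinearMap.ker (boundary G)).liftQ (pair c.1) hker ∘ₗ (boundary G).quotKerEquivRange.symm)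
  have hb' (z : G × G →₀ Z.{u}) : b (boundary G z) = pair c.1 z := by
    refine (LinearMap.congr_fun hb ⟨_, LinearMap.mem_range_self _ z⟩).trans ?_
    simp only [LinearMap.comp_apply, LinearEquiv.coe_coe,
      LinearMap.quotKerEquivRange_symm_apply_image, Submodule.mkQ_apply, Submodule.liftQ_apply]
  refine (cocClass_eq_zero_iff c).2 ⟨fun g => b (Finsupp.single g 1), fun g h => ?_⟩
  rw [← pair_single c.1, ← hb', boundary_single, map_add, map_sub]

lemma mem_coc_of_vanishing_on_boundaries (F : (G × G →₀ Z.{u}) →ₗ[Z.{u}] M)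
    (hF : ∀ z : Cyc G, cycClass G z = 0 → F z.1 = 0) :
    (fun p => F (Finsupp.single p 1)) ∈ Coc G M := by
  rw [groupCohomology.mem_cocycles₂_iff]
  intro g h j
  let y : G × G × G →₀ Z.{u} := Finsupp.single (g, h, j) 1
  have hcycle : groupHomology.d₃₂ (Rep.trivial Z.{u} G Z.{u}) y ∈ Cyc G := by
    have hd := groupHomology.d₃₂_comp_d₂₁ (Rep.trivial Z.{u} G Z.{u})
    exact congrArg (fun f => f.hom y) hd
  have hboundary := hF ⟨_, hcycle⟩
    ((groupHomology.H2π_eq_zero_iff (A := Rep.trivial Z.{u} G Z.{u}) _).2 ⟨y, rfl⟩)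
  have hy : groupHomology.d₃₂ (Rep.trivial Z.{u} G Z.{u}) y =
      (Finsupp.single (h, j) 1 - Finsupp.single (g * h, j) 1 + Finsupp.single (g, h * j) 1 -
        Finsupp.single (g, h) 1 : G × G →₀ Z.{u}) :=
    groupHomology.d₃₂_single (A := Rep.trivial Z.{u} G Z.{u}) (g, h, j) 1
  simp only [hy, map_sub, map_add] at hboundary
  rw [sub_eq_zero, sub_add_eq_add_sub, sub_eq_iff_eq_add] at hboundary
  exact (add_comm _ _).trans hboundary.symm

lemma evaluation_surjective [Module.Projective Z.{u} (H₁ G)] :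
    Function.Surjective (evaluation G M) := by
  intro f
  let fCyc : Cyc G →ₗ[Z.{u}] M :=
    { toFun := fun z => f (cycClass G z)
      map_add' := (f.comp (cycClass G)).map_add
      map_smul' := fun n => (f.comp (cycClass G)).map_zsmul n.down }
  have := projective_chains_quotient_cycles (G := G)
  obtain ⟨F, hF⟩ := exists_extend_of_projective_quotient (Cyc G) fCyc
  replace hF (z : Cyc G) : F z.1 = f (cycClass G z) := LinearMap.congr_fun hF z
  let c : Coc G M := ⟨_, mem_coc_of_vanishing_on_boundaries F fun z hz => by
    rw [hF, hz, map_zero]⟩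
  have hpair : pair c.1 = F := by
    ext p
    exact pair_single c.1 p
  refine ⟨cocClass G M c, AddMonoidHom.ext fun x => ?_⟩
  obtain ⟨z, rfl⟩ := cycClass_surjective x
  rw [evaluation_cocClass, evalCocycle_cycClass, hpair, hF]

theorem evaluation_bijective [Module.Projective Z.{u} (H₁ G)] :
    Function.Bijective (evaluation G M) :=
  ⟨evaluation_injective, evaluation_surjective⟩

end GroupH2

/-! ## Central extensions and their classes -/

namespace GroupH2

lemma exists_map_inl {G N N' E E' : Type*} [Group G] [Group N] [Group N'] [Group E] [Group E']
    {S : GroupExtension N E G} {S' : GroupExtension N' E' G} (F : E →* E')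
    (hF : S'.rightHom.comp F = S.rightHom) :
    ∃ f : N →* N', S'.inl.comp f = F.comp S.inl := by
  have hmem (a : N) : F (S.inl a) ∈ S'.inl.range := by
    rw [S'.range_inl_eq_ker_rightHom, MonoidHom.mem_ker, ← MonoidHom.comp_apply, hF,
      S.rightHom_inl]
  refine ⟨(MonoidHom.ofInjective S'.inl_injective).symm.toMonoidHom.comp
    ((F.comp S.inl).codRestrict S'.inl.range hmem), MonoidHom.ext fun a => ?_⟩
  exact MonoidHom.apply_ofInjective_symm S'.inl_injective ⟨_, hmem a⟩

variable {G : Type u} [Group G] {M M' : Type u} [AddCommGroup M] [AddCommGroup M']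
  {N N' E E' : Type u} [CommGroup N] [CommGroup N'] [Group E] [Group E']

lemma evaluation_pontryagin (c : Coc G M) {g h : G} (hgh : Commute g h) :
    evaluation G M (cocClass G M c) (pontryagin g h hgh) = c.1 (g, h) - c.1 (h, g) := by
  rw [evaluation_cocClass, pontryagin, evalCocycle_cycClass, map_sub, pair_single, pair_single]

/-- The pushforward of a 2-cocycle along a homomorphism of coefficient groups. -/
def mapCoc (f : M →+ M') (c : Coc G M) : Coc G M' :=
  ⟨fun p => f (c.1 p), (groupCohomology.mem_cocycles₂_iff (A := Rep.trivial Z.{u} G M') _).2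
    fun g h j => by
      rw [← map_add, coc_eq, map_add]
      rfl⟩

lemma mapCoc_apply (f : M →+ M') (c : Coc G M) (p : G × G) : (mapCoc f c).1 p = f (c.1 p) := rfl

lemma evaluation_mapCoc (f : M →+ M') (c : Coc G M) :
    evaluation G M' (cocClass G M' (mapCoc f c)) = f.comp (evaluation G M (cocClass G M c)) := by
  ext x
  obtain ⟨z, rfl⟩ := cycClass_surjective x
  simp only [AddMonoidHom.comp_apply, evaluation_cocClass_cycClass, Finsupp.sum, map_sum,
    map_zsmul, mapCoc_apply]

namespace CocycleGroup

variable {c : Coc G (Additive N)} {c' : Coc G (Additive N')}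

lemma commute_iff {u v : CocycleGroup c} {g h : G} (hu : u.right = g) (hv : v.right = h)
    (hgh : Commute g h) :
    Commute u v ↔ evaluation G (Additive N) (cocClass G _ c) (pontryagin g h hgh) = 0 := by
  subst hu hv
  rw [evaluation_pontryagin, sub_eq_zero]
  calc Commute u v
      ↔ u.left * v.left * mulCoc c u.right v.right = v.left * u.left * mulCoc c v.right u.right :=
        CocycleGroup.ext_iff.trans (and_iff_left hgh)
    _ ↔ mulCoc c u.right v.right = mulCoc c v.right u.right := by
        rw [mul_comm v.left, mul_right_inj]

lemma inl_mul (a : N) (u : CocycleGroup c) :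
    (cocycleExtension c).inl a * u = ⟨a * u.left, u.right⟩ := by
  ext
  · change a * (mulCoc c 1 1)⁻¹ * u.left * mulCoc c 1 u.right = _
    rw [mulCoc_one_left c u.right, mul_right_comm _ u.left, inv_mul_cancel_right]
  · exact one_mul u.right

lemma mk_one_mul_mk_one (g h : G) : (⟨1, g⟩ * ⟨1, h⟩ : CocycleGroup c) =
    (cocycleExtension c).inl (mulCoc c g h) * ⟨1, g * h⟩ := by
  rw [inl_mul]
  ext <;> simp

lemma cocClass_eq_of_hom (F : CocycleGroup c →* CocycleGroup c') (f : N →* N')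
    (hinl : ∀ a, F ((cocycleExtension c).inl a) = (cocycleExtension c').inl (f a))
    (hright : ∀ u, (F u).right = u.right) :
    cocClass G (Additive N') c' = cocClass G (Additive N') (mapCoc f.toAdditive c) := by
  rw [← sub_eq_zero, ← map_sub, cocClass_eq_zero_iff]
  let b (g : G) : Additive N' := .ofMul (F ⟨1, g⟩).left
  refine ⟨fun g => -b g, fun g h => ?_⟩
  have hF : F ⟨1, g⟩ * F ⟨1, h⟩ =
      (cocycleExtension c').inl (f (mulCoc c g h)) * F ⟨1, g * h⟩ := by
    rw [← map_mul, mk_one_mul_mk_one, map_mul, hinl]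
  have hb : b g + b h + c'.1 (g, h) = f.toAdditive (c.1 (g, h)) + b (g * h) := by
    have := congrArg left hF
    rw [inl_mul, mul_left, hright, hright] at this
    exact this
  change c'.1 (g, h) - f.toAdditive (c.1 (g, h)) = -b h - -b (g * h) + -b g
  rw [eq_sub_of_add_eq' hb]
  abel

lemma exists_extend_of_cocClass_mapCoc_eq_zero (f : Additive N →+ M)
    (hf : cocClass G M (mapCoc f c) = 0) : ∃ F : CocycleGroup c →* Multiplicative M,
      F.comp (cocycleExtension c).inl = AddMonoidHom.toMultiplicativeRight f := by
  obtain ⟨b, hb⟩ := (cocClass_eq_zero_iff _).1 hf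
  simp only [mapCoc_apply] at hb
  refine ⟨.mk' (fun u => .ofAdd (f (.ofMul u.left) + b u.right)) fun u v => ?_,
    MonoidHom.ext fun a => ?_⟩
  · change f (Additive.ofMul u.left + Additive.ofMul v.left + c.1 (u.right, v.right)) +
      b (u.right * v.right) = f (Additive.ofMul u.left) + b u.right +
        (f (Additive.ofMul v.left) + b v.right)
    rw [map_add, map_add, hb]
    abel
  · change f (Additive.ofMul a + -c.1 (1, 1)) + b 1 = f (Additive.ofMul a)
    rw [map_add, map_neg, hb, mul_one]
    abel

end CocycleGroup

namespace HasClass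

variable {S : GroupExtension N E G} {κ : Hc₂ G (Additive N)}
  {S' : GroupExtension N' E' G} {κ' : Hc₂ G (Additive N')}

lemma of_cocycleExtension (c : Coc G (Additive N)) :
    HasClass (cocycleExtension c) (cocClass G _ c) :=
  ⟨c, rfl, ⟨.refl _⟩⟩

lemma commute_iff (hκ : HasClass S κ) {u v : E} {g h : G} (hu : S.rightHom u = g)
    (hv : S.rightHom v = h) (hgh : Commute g h) :
    Commute u v ↔ evaluation G (Additive N) κ (pontryagin g h hgh) = 0 := by
  obtain ⟨c, rfl, ⟨T⟩⟩ := hκ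
  rw [← CocycleGroup.commute_iff ((T.rightHom_map u).trans hu) ((T.rightHom_map v).trans hv) hgh]
  exact (commute_map_iff (EquivLike.injective T)).symm

lemma exists_extend [Module.Projective Z.{u} (H₁ G)] (hκ : HasClass S κ) (f : Additive N →+ M)
    (hf : f.comp (evaluation G _ κ) = 0) :
    ∃ F : E →* Multiplicative M, F.comp S.inl = AddMonoidHom.toMultiplicativeRight f := by
  obtain ⟨c, rfl, ⟨T⟩⟩ := hκ
  obtain ⟨F, hF⟩ := CocycleGroup.exists_extend_of_cocClass_mapCoc_eq_zero f <|
    evaluation_injective (((evaluation_mapCoc f c).trans hf).trans (map_zero _).symm)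
  refine ⟨F.comp T.toMulEquiv.toMonoidHom, ?_⟩
  rw [← hF]
  exact MonoidHom.ext fun a => congrArg F (T.map_inl a)

lemma exists_evaluation_eq_comp (hκ : HasClass S κ) (hκ' : HasClass S' κ') (F : E →* E')
    (hF : S'.rightHom.comp F = S.rightHom) : ∃ f : Additive N →+ Additive N',
      evaluation G _ κ' = f.comp (evaluation G _ κ) := by
  obtain ⟨c, rfl, ⟨T⟩⟩ := hκ
  obtain ⟨c', rfl, ⟨T'⟩⟩ := hκ'
  obtain ⟨f, hf⟩ := exists_map_inl F hF
  refine ⟨f.toAdditive, ?_⟩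
  rw [← evaluation_mapCoc]
  refine congrArg _ (CocycleGroup.cocClass_eq_of_hom
    (T'.toMulEquiv.toMonoidHom.comp (F.comp T.symm.toMulEquiv.toMonoidHom)) f ?_ ?_)
  · intro a
    calc T' (F (T.symm ((cocycleExtension c).inl a)))
        = T' (S'.inl (f a)) := by
          rw [T.symm.map_inl]
          exact congrArg T' (DFunLike.congr_fun hf a).symm
      _ = (cocycleExtension c').inl (f a) := T'.map_inl _
  · intro u
    calc (cocycleExtension c').rightHom (T' (F (T.symm u)))
        = S'.rightHom (F (T.symm u)) := T'.rightHom_map _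
      _ = S.rightHom (T.symm u) := DFunLike.congr_fun hF _
      _ = (cocycleExtension c).rightHom u := T.symm.rightHom_map u

lemma mem_range_evaluation [Module.Projective Z.{u} (H₁ G)] (hκ : HasClass S κ) {a : N}
    (ha : S.inl a ∈ commutator E) : Additive.ofMul a ∈ (evaluation G _ κ).range := by
  let q := QuotientAddGroup.mk' (evaluation G _ κ).range
  obtain ⟨F, hF⟩ := hκ.exists_extend q <|
    AddMonoidHom.ext fun x => (QuotientAddGroup.eq_zero_iff _).2 ⟨x, rfl⟩
  have hFa : F (S.inl a) = 1 := Abelianization.commutator_subset_ker F ha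
  exact (QuotientAddGroup.eq_zero_iff _).1 ((DFunLike.congr_fun hF a).symm.trans hFa)

end HasClass

section IsFactorSet

variable {S : GroupExtension N E G}

/-- The cocycle `c` is the factor set of the section `σ`: it measures the failure of `σ` to be
multiplicative. -/
def IsFactorSet (σ : S.Section) (c : Coc G (Additive N)) : Prop :=
  ∀ g h, σ g * σ h = S.inl (CocycleGroup.mulCoc c g h) * σ (g * h)

lemma exists_isFactorSet (hS : ∀ a x, Commute (S.inl a) x) (σ : S.Section) :
    ∃ c : Coc G (Additive N), IsFactorSet σ c := by
  choose c hc using σ.mul_mul_mul_inv_mem_range_inl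
  replace hc (g h : G) : σ g * σ h = S.inl (c g h) * σ (g * h) :=
    mul_inv_eq_iff_eq_mul.1 (hc g h).symm
  refine ⟨⟨fun p => .ofMul (c p.1 p.2), ?_⟩, hc⟩
  rw [groupCohomology.mem_cocycles₂_iff]
  intro g h j
  apply S.inl_injective
  apply mul_right_cancel (b := σ (g * h * j))
  calc S.inl (c (g * h) j * c g h) * σ (g * h * j)
      = S.inl (c g h) * (S.inl (c (g * h) j) * σ (g * h * j)) := by
        rw [mul_comm, map_mul, mul_assoc]
    _ = σ g * (σ h * σ j) := by rw [← hc, ← mul_assoc, ← hc, mul_assoc]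
    _ = σ g * (S.inl (c h j) * σ (h * j)) := by rw [hc h j]
    _ = S.inl (c h j) * (σ g * σ (h * j)) := ((hS _ _).left_comm _).symm
    _ = S.inl (c h j * c g (h * j)) * σ (g * h * j) := by
        rw [hc, map_mul S.inl, mul_assoc g h j, mul_assoc]

lemma IsFactorSet.hasClass (hS : ∀ a x, Commute (S.inl a) x) {σ : S.Section}
    {c : Coc G (Additive N)} (hc : IsFactorSet σ c) : HasClass S (cocClass G _ c) := by
  let F : CocycleGroup c →* E := .mk' (fun u => S.inl u.left * σ u.right) fun u v => by
    rw [CocycleGroup.mul_left, CocycleGroup.mul_right, map_mul, map_mul, mul_assoc _ (S.inl _),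
      ← hc, ← mul_assoc, mul_assoc (S.inl u.left), (hS v.left _).eq]
    simp only [mul_assoc]
  have hσ : S.inl (CocycleGroup.mulCoc c 1 1) = σ 1 :=
    mul_right_cancel ((hc 1 1).symm.trans (by rw [mul_one]))
  have hinl : F.comp (cocycleExtension c).inl = S.inl := MonoidHom.ext fun a => by
    change S.inl (a * (CocycleGroup.mulCoc c 1 1)⁻¹) * σ 1 = S.inl a
    rw [map_mul, map_inv, hσ, inv_mul_cancel_right]
  have hright : S.rightHom.comp F = (cocycleExtension c).rightHom := MonoidHom.ext fun u => by
    change S.rightHom (S.inl u.left * σ u.right) = u.right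
    rw [map_mul, S.rightHom_inl, one_mul, σ.rightHom_section]
  exact ⟨c, rfl, ⟨(GroupExtension.Equiv.ofMonoidHom F hinl hright).symm⟩⟩

theorem exists_hasClass (hS : ∀ a x, Commute (S.inl a) x) :
    ∃ κ : Hc₂ G (Additive N), HasClass S κ := by
  obtain ⟨c, hc⟩ := exists_isFactorSet hS S.surjInvRightHom
  exact ⟨_, hc.hasClass hS⟩

end IsFactorSet

lemma exists_ker_evaluation_cocClass_eq [Module.Projective Z.{u} (H₁ G)]
    (P : AddSubgroup (H₂ G)) :
    ∃ c : Coc G (Additive (Multiplicative (H₂ G ⧸ P))),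
      (evaluation G _ (cocClass G _ c)).ker = P := by
  obtain ⟨κ, hκ⟩ := evaluation_surjective
    ((AddEquiv.additiveMultiplicative (H₂ G ⧸ P)).symm.toAddMonoidHom.comp
      (QuotientAddGroup.mk' P))
  obtain ⟨c, rfl⟩ := cocClass_surjective κ
  refine ⟨c, ?_⟩
  rw [hκ]
  exact QuotientAddGroup.ker_mk' P

end GroupH2

/-! ## The associated group of a rack -/

namespace AssocGroup

open GroupH2

variable {X : Type u} [Rack X]

/-- The right action of `InnBar X` on `X` through the second projection. -/
def act (x : X) (g : InnBar X) : X := actInn x g.1.2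

lemma act_mul (x : X) (g h : InnBar X) : act x (g * h) = act (act x g) h := rfl

lemma act_mul_inv_cancel (x : X) (g : InnBar X) : act (act x g) g⁻¹ = x := by
  rw [← act_mul, mul_inv_cancel]
  rfl

lemma act_sBar (x y : X) : act x (sBar y) = y ◃ x := by
  rw [← actInn_s, ← ψ_e]
  rfl

lemma mem_stab {x : X} {g : InnBar X} : g ∈ stab x ↔ act x g = x := Iff.rfl

lemma sBar_mul (x : X) (g : InnBar X) : sBar x * g = g * sBar (act x g) := by
  obtain ⟨a, rfl⟩ := (αψ X).rangeRestrict_surjective g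
  exact (map_mul _ _ _).symm.trans
    ((congrArg (αψ X).rangeRestrict (e_mul a x)).trans (map_mul _ _ _))

lemma ψ_surjective : Function.Surjective (ψ X) := by
  have hrange : Inn X ≤ (ψ X).range.map (Inn X).subtype :=
    (Subgroup.closure_le _).2 fun _ ⟨x, hx⟩ => ⟨s x, ⟨e x, ψ_e x⟩, hx⟩
  intro g
  obtain ⟨_, ⟨a, rfl⟩, ha⟩ := hrange g.2
  exact ⟨a, Subtype.ext ha⟩

lemma orbit_act_eq (x : X) (g : InnBar X) : orbit (act x g) = orbit x :=
  (Quotient.sound (s := orbitSetoid X) ⟨g.1.2, rfl⟩).symm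

lemma exists_act_out (x : X) : ∃ g : InnBar X, act (orbit x).out g = x := by
  obtain ⟨g, hg⟩ : (orbitSetoid X).r (orbit x).out x := Quotient.exact (Quotient.out_eq _)
  obtain ⟨a, rfl⟩ := ψ_surjective g
  exact ⟨(αψ X).rangeRestrict a, hg⟩

section Commutative

variable {H : Type*} [CommGroup H]

lemma map_e_out (f : As X →* H) (x : X) : f (e (orbit x).out) = f (e x) := by
  obtain ⟨g, hg⟩ := exists_act_out x
  obtain ⟨a, rfl⟩ := (αψ X).rangeRestrict_surjective g
  have hconj : f (e (orbit x).out) * f a = f a * f (e x) := by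
    rw [← map_mul, ← map_mul, e_mul a]
    exact congrArg (fun y => f (a * e y)) hg
  exact mul_left_cancel ((mul_comm _ _).trans hconj)

lemma exists_comp_α_eq (f : As X →* H) :
    ∃ k : Multiplicative (Orbits X →₀ ℤ) →* H, k.comp (α X) = f := by
  let k : (Orbits X →₀ ℤ) →+ Additive H :=
    Finsupp.liftAddHom fun o => zmultiplesHom _ (.ofMul (f (e o.out)))
  refine ⟨AddMonoidHom.toMultiplicativeLeft k, PresentedGroup.ext fun x => ?_⟩
  calc AddMonoidHom.toMultiplicativeLeft k (α X (e x)) = f (e (orbit x).out) := by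
        rw [α_e]
        simp [k]
    _ = f (e x) := map_e_out f x

end Commutative

lemma ker_α_le_commutator : (α X).ker ≤ commutator (As X) := by
  obtain ⟨k, hk⟩ := exists_comp_α_eq (Abelianization.of (G := As X))
  rw [← Abelianization.ker_of, ← hk, ← MonoidHom.comap_ker]
  exact (α X).ker_le_comap _

instance : Module.Projective ℤ (Additive (Abelianization (InnBar X))) := by
  let π : InnBar X →* Multiplicative (Orbits X →₀ ℤ) :=
    (MonoidHom.fst _ _).comp (InnBar X).subtype
  obtain ⟨k, hk⟩ := exists_comp_α_eq (Abelianization.of.comp (αψ X).rangeRestrict)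
  have hretract : k.comp (Abelianization.lift π) = .id _ := by
    refine Abelianization.hom_ext _ _ ?_
    exact (MonoidHom.cancel_right (αψ X).rangeRestrict_surjective).1 hk
  refine .of_split (MonoidHom.toAdditiveLeft (Abelianization.lift π)).toIntLinearMap
    (MonoidHom.toAdditiveRight k).toIntLinearMap ?_
  exact LinearMap.ext fun x => DFunLike.congr_fun hretract x.toMul

instance : Module.Projective Z.{u} (H₁ (InnBar X)) := projective_H₁

section Lift

variable {E : Type*} [Group E] {p : E →* InnBar X}

/-- In the group `E` over `InnBar X`, all lifts of `sBar x` commute with all lifts of elements of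
the stabilizer of `x`. This is the condition for `As X` to map to `E` over `InnBar X`. -/
def LiftsCommute (p : E →* InnBar X) : Prop :=
  ∀ x u v, p u = sBar x → p v ∈ stab x → Commute u v

lemma LiftsCommute.conj_eq_conj (hcomm : LiftsCommute p) {x : X} {u v w : E}
    (hu : p u = sBar x) (hvw : act x (p v) = act x (p w)) :
    v⁻¹ * u * v = w⁻¹ * u * w := by
  have hstab : p (v * w⁻¹) ∈ stab x := by
    rw [mem_stab, map_mul, map_inv, act_mul, hvw, act_mul_inv_cancel]
  calc v⁻¹ * u * v = v⁻¹ * (u * (v * w⁻¹)) * w := by group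
    _ = v⁻¹ * (v * w⁻¹ * u) * w := by rw [(hcomm x u _ hu hstab).eq]
    _ = w⁻¹ * u * w := by group

lemma exists_equivariant_lift (hp : Function.Surjective p)
    (hcomm : LiftsCommute p) :
    ∃ t : X → E, (∀ x, p (t x) = sBar x) ∧ ∀ x v, t x * v = v * t (act x (p v)) := by
  choose σ hσ using hp
  have hmove (x : X) : ∃ w, act (orbit x).out (p w) = x :=
    (exists_act_out x).imp' σ fun g hg => by rwa [hσ]
  choose w hw using hmove
  let t (x : X) : E := (w x)⁻¹ * σ (sBar (orbit x).out) * w x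
  refine ⟨t, fun x => ?_, fun x v => ?_⟩
  · simp only [t, map_mul, map_inv, hσ]
    rw [mul_assoc, sBar_mul, hw, inv_mul_cancel_left]
  · have hconj : (w x * v)⁻¹ * σ (sBar (orbit x).out) * (w x * v) = t (act x (p v)) := by
      have hy := hw (act x (p v))
      simp only [t]
      rw [orbit_act_eq] at hy ⊢
      exact hcomm.conj_eq_conj (hσ _) (by rw [map_mul, act_mul, hw, hy])
    rw [← hconj]
    simp only [t]
    group

lemma exists_lift (hp : Function.Surjective p) (hcomm : LiftsCommute p) :
    ∃ f : As X →* E, p.comp f = (αψ X).rangeRestrict := by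
  obtain ⟨t, hpt, ht⟩ := exists_equivariant_lift hp hcomm
  refine ⟨PresentedGroup.toGroup (f := t) ?_, PresentedGroup.ext fun x => ?_⟩
  · rintro _ ⟨x, y, rfl⟩
    simp only [map_mul, map_inv, FreeGroup.lift_apply_of]
    rw [mul_inv_eq_one, ht, hpt, act_sBar]
  · rw [MonoidHom.comp_apply, PresentedGroup.toGroup.of, hpt]
    rfl

end Lift

lemma pontryagin_mem_pontryaginSubgroup {x : X} {g : InnBar X} (hg : g ∈ stab x) :
    pontryagin (sBar x) g (commute_sBar x hg) ∈ pontryaginSubgroup X :=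
  AddSubgroup.mem_iSup_of_mem x (AddSubgroup.subset_closure ⟨g, hg, rfl⟩)

lemma liftsCommute_iff {N E : Type u} [CommGroup N] [Group E] {S : GroupExtension N E (InnBar X)}
    {κ : Hc₂ (InnBar X) (Additive N)} (hκ : HasClass S κ) :
    LiftsCommute S.rightHom ↔ pontryaginSubgroup X ≤ (evaluation _ _ κ).ker := by
  constructor
  · intro hcomm
    refine iSup_le fun x => (AddSubgroup.closure_le _).2 ?_
    rintro _ ⟨g, hg, rfl⟩
    obtain ⟨u, hu⟩ := S.rightHom_surjective (sBar x)
    obtain ⟨v, rfl⟩ := S.rightHom_surjective g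
    exact (hκ.commute_iff hu rfl (commute_sBar x hg)).1 (hcomm x u v hu hg)
  · intro hle x u v hu hv
    exact (hκ.commute_iff hu rfl (commute_sBar x hv)).2 (hle (pontryagin_mem_pontryaginSubgroup hv))

lemma liftsCommute_asExtension : LiftsCommute (asExtension X).rightHom := by
  intro x u v hu hv
  have hcomm : Commute (e x) v := (e_mul v x).trans (congrArg (fun y => v * e y) hv)
  have hcentral : (e x)⁻¹ * u ∈ Subgroup.center (As X) :=
    A_le_center ((MonoidHom.eq_iff _).1 (congrArg Subtype.val hu))
  rw [← mul_inv_cancel_left (e x) u]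
  exact hcomm.mul_left (Subgroup.mem_center_iff.1 hcentral v).symm

variable {κ : Hc₂ (InnBar X) (Additive (A X))}

lemma evaluation_asExtension_surjective (hκ : HasClass (asExtension X) κ) :
    Function.Surjective (evaluation _ _ κ) := fun a =>
  hκ.mem_range_evaluation <| ker_α_le_commutator <|
    congrArg Prod.fst (MonoidHom.mem_ker.1 a.toMul.2)

lemma ker_evaluation_asExtension_le (hκ : HasClass (asExtension X) κ) :
    (evaluation _ _ κ).ker ≤ pontryaginSubgroup X := by
  obtain ⟨c, hker⟩ := exists_ker_evaluation_cocClass_eq (pontryaginSubgroup X)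
  have hc := HasClass.of_cocycleExtension c
  obtain ⟨F, hF⟩ := exists_lift (cocycleExtension c).rightHom_surjective
    ((liftsCommute_iff hc).2 hker.ge)
  obtain ⟨f, hf⟩ := hκ.exists_evaluation_eq_comp hc F hF
  rw [← hker, hf, ← AddMonoidHom.comap_ker]
  exact AddMonoidHom.ker_le_comap _ _

theorem ker_evaluation_asExtension (hκ : HasClass (asExtension X) κ) :
    (evaluation _ _ κ).ker = pontryaginSubgroup X :=
  le_antisymm (ker_evaluation_asExtension_le hκ) ((liftsCommute_iff hκ).1 liftsCommute_asExtension)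

variable (X) in
lemma commute_inl_asExtension (a : A X) (g : As X) : Commute ((asExtension X).inl a) g :=
  (Subgroup.mem_center_iff.1 (A_le_center a.2) g).symm

end AssocGroup

end

/-- For every rack `X`: evaluation `H²(InnBar X, A) → Hom(H₂(InnBar X), A)` is an isomorphism, and
there is an isomorphism `θ` from the quotient of `H₂(InnBar X)` by the Pontryagin products onto `A`
such that the central extension `A → As(X) → InnBar X` is the one associated with the class
corresponding to the projection `H₂(InnBar X) → A`. -/
theorem theorem3p1 (X : Type u) [Rack X] :
    Function.Bijective
      (GroupH2.evaluation (AssocGroup.InnBar X) (Additive (AssocGroup.A X))) ∧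
    ∃ θ : (GroupH2.H₂ (AssocGroup.InnBar X) ⧸ AssocGroup.pontryaginSubgroup X) ≃+
        Additive (AssocGroup.A X),
      ∃ κ : GroupH2.Hc₂ (AssocGroup.InnBar X) (Additive (AssocGroup.A X)),
        GroupH2.evaluation (AssocGroup.InnBar X) (Additive (AssocGroup.A X)) κ =
          θ.toAddMonoidHom.comp (QuotientAddGroup.mk' (AssocGroup.pontryaginSubgroup X)) ∧
        GroupH2.HasClass (AssocGroup.asExtension X) κ := by
  refine ⟨GroupH2.evaluation_bijective, ?_⟩
  obtain ⟨κ, hκ⟩ := GroupH2.exists_hasClass (AssocGroup.commute_inl_asExtension X)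
  let θ := (QuotientAddGroup.quotientAddEquivOfEq
      (AssocGroup.ker_evaluation_asExtension hκ).symm).trans
    (QuotientAddGroup.quotientKerEquivOfSurjective _
      (AssocGroup.evaluation_asExtension_surjective hκ))
  exact ⟨θ, κ, rfl, hκ⟩
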